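/- Let $\mathcal{C}$ be an elementary topos (a finitely complete cartesian closed category with a subobject classifier $\Omega$), $X$ an object of $\mathcal{C}$, and $PX=\Omega^X$ its power object, with membership relation $\in_X$ and with its internal Heyting algebra structure (operations $\wedge$, $\vee$, $\neg_X$, least element $\emptyset$, greatest element $X$, order $\preceq_X$). All formulas below are formulas of the internal language of $\mathcal{C}$, and to hold means to be valid, i.e. to be interpreted as the largest subobject of the context. Let $\mathcal{F}\colon PPX\to\Omega$ be the morphism defined by the axioms of a strict filter on a variable $F:PPX$: \[\forall A.\forall B.\ A\in_{PX}F\wedge B\in_{PX}F\Rightarrow A\wedge B\in_{PX}F,\qquad \forall A.\forall B.\ A\in_{PX}F\wedge A\preceq_X B\Rightarrow B\in_{PX}F,\] \[X\in_{PX}F,\qquad \forall A.\ A\in_{PX}F\Rightarrow\exists x.\ x\in_X A.\] Let $N\colon X\to PPX$ be a structuring neighborhood, i.e. a morphism such that $\forall x.\ \mathcal{F}(N(x))$ and $\forall x.\forall A.\ A\in_{PX}N(x)\Rightarrow x\in_X A$ hold. Define morphisms $\varepsilon[N],\delta[N]\colon PX\to PX$ by \[\varepsilon[N](Y)=\{x:X\mid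 Y\in_{PX}N(x)\},\qquad \delta[N](Y)=\{x:X\mid\exists F.\ \mathcal{F}(F)\wedge Y\in_{PX}F\wedge N(x)\preceq_{PX}F\}.\] Then $\delta[N](Y)=\{x:X\mid\forall A.\ A\in_{PX}N(x)\Rightarrow\exists y.\ y\in_X A\wedge Y\}$, and the following hold: \begin{itemize} \item $\forall Y.\forall Z.\ Y\preceq_X Z\Rightarrow\varepsilon[N](Y)\preceq_X\varepsilon[N](Z)$ and $\forall Y.\forall Z.\ Y\preceq_X Z\Rightarrow\delta[N](Y)\preceq_X\delta[N](Z)$; \item $\forall A.\forall B.\ \varepsilon[N](A\wedge B)=\varepsilon[N](A)\wedge\varepsilon[N](B)$, $\ \varepsilon[N](X)=X$, and $\forall Y.\ \varepsilon[N](Y)\preceq_X Y$; \item $\forall A.\forall B.\ \delta[N](A)\vee\delta[N](B)\preceq_X\delta[N](A\vee B)$, $\ \delta[N](\emptyset)=\emptyset$, and $\forall Y.\ Y\preceq_X\delta[N](Y)$; \item $\forall Y.\ \varepsilon[N](\neg_X Y)\preceq_X\neg_X\delta[N](Y)$. \end{itemize} -/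

import Mathlib

open CategoryTheory CategoryTheory.Limits MonoidalCategory CartesianMonoidalCategory

/-- An elementary topos: finite limits, cartesian closed, and a subobject classifier.  The finite
products (`X ⊗ Y`, `𝟙_ C`), the exponentials and the classifier are arbitrary chosen ones. -/
class ElementaryTopos (C : Type*) [Category* C] [CartesianMonoidalCategory C] extends
    HasFiniteLimits C, MonoidalClosed C where
  /-- The subobject classifier `true : 1 ⟶ Ω`. -/
  classifier : Subobject.Classifier C

namespace ElementaryTopos

noncomputable section

universe v u

/-! ### Generalised elements of subobjects -/

theorem le_iff {C : Type u} [Category.{v} C] {Γ : C} {φ ψ : Subobject Γ} :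
    φ ≤ ψ ↔ ∀ ⦃Δ : C⦄ (f : Δ ⟶ Γ), φ.Factors f → ψ.Factors f :=
  ⟨fun h _ f hf => Subobject.factors_of_le f h hf,
    fun h => Subobject.le_of_factors (h _ φ.factors_self)⟩

theorem ext_iff' {C : Type u} [Category.{v} C] {Γ : C} {φ ψ : Subobject Γ} :
    φ = ψ ↔ ∀ ⦃Δ : C⦄ (f : Δ ⟶ Γ), φ.Factors f ↔ ψ.Factors f :=
  ⟨fun h _ _ => h ▸ Iff.rfl, fun h =>
    le_antisymm (le_iff.2 fun _ f => (h f).1) (le_iff.2 fun _ f => (h f).2)⟩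

section

variable {C : Type u} [Category.{v} C] [CartesianMonoidalCategory C] [ElementaryTopos C]

/-! ### Truth values and power objects -/

variable (C) in
/-- The object of truth values. -/
abbrev Omega : C := (classifier (C := C)).Ω

/-- The characteristic morphism of a subobject. -/
def char {Γ : C} (φ : Subobject Γ) : Γ ⟶ Omega C :=
  (classifier (C := C)).χ φ.arrow

/-- The subobject classified by `t : Γ ⟶ Ω` (the pullback of `true` along `t`), that is, the
formula given by the term `t` of type `Ω`. -/
def holds {Γ : C} (t : Γ ⟶ Omega C) : Subobject Γ :=
  (Subobject.pullback t).obj (Subobject.mk (classifier (C := C)).truth)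

/-- The power object `PX = Ω^X`. -/
abbrev Power (X : C) : C := (ihom X).obj (Omega C)

theorem factors_pullback {Γ Δ Δ' : C} (f : Δ ⟶ Γ) (φ : Subobject Γ) (g : Δ' ⟶ Δ) :
    ((Subobject.pullback f).obj φ).Factors g ↔ φ.Factors (g ≫ f) := by
  have h := Subobject.isPullback f φ
  constructor
  · intro hg
    rw [← Subobject.factorThru_arrow _ g hg, Category.assoc, ← h.w, ← Category.assoc]
    exact Subobject.factors_comp_arrow _
  · intro hg
    have := h.lift_snd (φ.factorThru _ hg) g (by simp)
    rw [← this]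
    exact Subobject.factors_comp_arrow _

theorem holds_char {Γ : C} (φ : Subobject Γ) : holds (char φ) = φ := by
  simp [holds, char]

theorem char_holds {Γ : C} (t : Γ ⟶ Omega C) : char (holds t) = t := by
  simp [holds, char]

theorem holds_injective {Γ : C} : Function.Injective (holds : (Γ ⟶ Omega C) → Subobject Γ) :=
  Function.LeftInverse.injective char_holds

theorem holds_comp {Γ Δ : C} (f : Δ ⟶ Γ) (t : Γ ⟶ Omega C) :
    holds (f ≫ t) = (Subobject.pullback f).obj (holds t) :=
  Subobject.pullback_comp _ _ _

theorem holds_comp_char {Γ Δ : C} (f : Δ ⟶ Γ) (φ : Subobject Γ) :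
    holds (f ≫ char φ) = (Subobject.pullback f).obj φ := by
  rw [holds_comp, holds_char]

/-! ### Implication and universal quantification -/

/-- Implication of subobjects: the equalizer of the characteristic morphisms of `φ ⊓ ψ` and `φ`. -/
def imp {Γ : C} (φ ψ : Subobject Γ) : Subobject Γ :=
  equalizerSubobject (char (φ ⊓ ψ)) (char φ)

theorem imp_factors {Γ Δ : C} (φ ψ : Subobject Γ) (f : Δ ⟶ Γ) :
    (imp φ ψ).Factors f ↔
      ∀ ⦃Δ' : C⦄ (g : Δ' ⟶ Δ), φ.Factors (g ≫ f) → ψ.Factors (g ≫ f) := by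
  rw [imp, equalizerSubobject_factors_iff, ← holds_injective.eq_iff, holds_comp_char,
    holds_comp_char, ext_iff']
  simp only [factors_pullback, Subobject.inf_factors]
  exact forall₂_congr fun _ _ => by tauto

/-- Universal quantification over a new variable of type `X`: if `φ` is a formula in the context
`X ⊗ Γ`, then `all X φ` is the equalizer of the transposes `Γ ⟶ PX` of the characteristic
morphism of `φ` and of the constantly true morphism. -/
def all (X : C) {Γ : C} (φ : Subobject (X ⊗ Γ)) : Subobject Γ :=
  equalizerSubobject (MonoidalClosed.curry (char φ)) (MonoidalClosed.curry (char ⊤))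

theorem all_factors {X Γ Δ : C} (φ : Subobject (X ⊗ Γ)) (f : Δ ⟶ Γ) :
    (all X φ).Factors f ↔
      ∀ ⦃Δ' : C⦄ (g : Δ' ⟶ Δ) (x : Δ' ⟶ X), φ.Factors (lift x (g ≫ f)) := by
  rw [all, equalizerSubobject_factors_iff, ← MonoidalClosed.curry_natural_left,
    ← MonoidalClosed.curry_natural_left, MonoidalClosed.curry_injective.eq_iff,
    ← holds_injective.eq_iff, holds_comp_char, holds_comp_char, ext_iff']
  simp only [factors_pullback, Subobject.top_factors, iff_true]
  constructor
  · intro h Δ' g x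
    simpa using h (lift x g)
  · intro h Δ' g
    have := h (g ≫ snd _ _) (g ≫ fst _ _)
    convert! this using 1
    ext <;> simp

/-- `all X` is right adjoint to pullback along the projection `X ⊗ Γ ⟶ Γ`. -/
theorem le_all_iff {X Γ : C} (ψ : Subobject Γ) (φ : Subobject (X ⊗ Γ)) :
    ψ ≤ all X φ ↔ (Subobject.pullback (snd X Γ)).obj ψ ≤ φ := by
  simp only [le_iff, all_factors, factors_pullback]
  constructor
  · intro h Δ f hf
    have := h _ hf (𝟙 _) (f ≫ fst _ _)
    convert! this using 1
    ext <;> simp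
  · intro h Δ f hf Δ' g x
    exact h _ (by simpa using Subobject.factors_of_factors_right g hf)

/-! ### The Heyting algebra of subobjects -/

theorem holds_fst_factors {Γ Δ : C} (ω : Δ ⟶ Omega C) (f : Δ ⟶ Γ) :
    (holds (fst (Omega C) Γ)).Factors (lift ω f) ↔ holds ω = ⊤ := by
  have h : holds ω = (Subobject.pullback (lift ω f)).obj (holds (fst (Omega C) Γ)) := by
    rw [← holds_comp, lift_fst]
  rw [h, ext_iff']
  simp only [factors_pullback, Subobject.top_factors, iff_true]
  exact ⟨fun h _ g => Subobject.factors_of_factors_right g h, fun h => by simpa using h (𝟙 _)⟩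

/-- The join of two subobjects, `∀ ω : Ω, (φ ⇒ ω) ∧ (ψ ⇒ ω) ⇒ ω`.  The instance below shows that it
is the least upper bound. -/
def join {Γ : C} (φ ψ : Subobject Γ) : Subobject Γ :=
  all (Omega C) (imp
    (imp ((Subobject.pullback (snd _ _)).obj φ) (holds (fst _ _)) ⊓
      imp ((Subobject.pullback (snd _ _)).obj ψ) (holds (fst _ _)))
    (holds (fst _ _)))

/-- The smallest subobject, `∀ ω : Ω, ω`. -/
def bottom (Γ : C) : Subobject Γ := all (Omega C) (holds (fst _ _))

theorem holds_fst_factors_char {Γ Δ : C} (φ : Subobject Γ) (f : Δ ⟶ Γ) :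
    (holds (fst (Omega C) Γ)).Factors (lift (f ≫ char φ) f) ↔ φ.Factors f := by
  rw [holds_fst_factors, holds_comp_char, ext_iff']
  simp only [factors_pullback, Subobject.top_factors, iff_true]
  exact ⟨fun h => by simpa using h (𝟙 _), fun h _ g => Subobject.factors_of_factors_right g h⟩

theorem bottom_le {Γ : C} (φ : Subobject Γ) : bottom Γ ≤ φ := by
  rw [le_iff]
  intro Δ f hf
  rw [bottom, all_factors] at hf
  have := hf (𝟙 _) (f ≫ char φ)
  rwa [Category.id_comp, holds_fst_factors_char] at this

theorem le_join_left {Γ : C} (φ ψ : Subobject Γ) : φ ≤ join φ ψ := by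
  rw [le_iff]
  intro Δ f hf
  simp only [join, all_factors, imp_factors, Subobject.inf_factors, factors_pullback]
  intro Δ' g ω Δ'' h H
  have := H.1 (𝟙 _) (by simpa using Subobject.factors_of_factors_right (h ≫ g) hf)
  simpa using this

theorem le_join_right {Γ : C} (φ ψ : Subobject Γ) : ψ ≤ join φ ψ := by
  rw [le_iff]
  intro Δ f hf
  simp only [join, all_factors, imp_factors, Subobject.inf_factors, factors_pullback]
  intro Δ' g ω Δ'' h H
  have := H.2 (𝟙 _) (by simpa using Subobject.factors_of_factors_right (h ≫ g) hf)
  simpa using this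

theorem join_le {Γ : C} (φ ψ χ : Subobject Γ) (h₁ : φ ≤ χ) (h₂ : ψ ≤ χ) : join φ ψ ≤ χ := by
  rw [le_iff]
  intro Δ f hf
  simp only [join, all_factors, imp_factors, Subobject.inf_factors, factors_pullback] at hf
  have key : ∀ {Δ' : C} (g : Δ' ⟶ Δ), g ≫ lift (f ≫ char χ) f =
      lift ((g ≫ f) ≫ char χ) (g ≫ f) := fun g => by ext <;> simp
  have := hf (𝟙 _) (f ≫ char χ) (𝟙 _) ⟨?_, ?_⟩
  · simpa [holds_fst_factors_char] using this
  · intro Δ' g hg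
    simp only [Category.id_comp, key, lift_snd] at hg ⊢
    exact (holds_fst_factors_char _ _).2 (Subobject.factors_of_le _ h₁ hg)
  · intro Δ' g hg
    simp only [Category.id_comp, key, lift_snd] at hg ⊢
    exact (holds_fst_factors_char _ _).2 (Subobject.factors_of_le _ h₂ hg)

theorem le_imp_iff {Γ : C} (φ ψ χ : Subobject Γ) : φ ≤ imp ψ χ ↔ φ ⊓ ψ ≤ χ := by
  simp only [le_iff, imp_factors, Subobject.inf_factors]
  constructor
  · intro h Δ f hf
    simpa using h f hf.1 (𝟙 _) (by simpa using hf.2)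
  · intro h Δ f hf Δ' g hg
    exact h _ ⟨Subobject.factors_of_factors_right g hf, hg⟩

/-- The subobjects of an object of a topos, with their usual order, form a Heyting algebra. -/
instance subobjectHeytingAlgebra (Γ : C) : HeytingAlgebra (Subobject Γ) :=
  { Subobject.semilatticeInf, Subobject.orderTop with
    sup := join
    le_sup_left := le_join_left
    le_sup_right := le_join_right
    sup_le := join_le
    bot := bottom Γ
    bot_le := bottom_le
    himp := imp
    le_himp_iff := le_imp_iff
    compl := fun φ => imp φ (bottom Γ)
    himp_bot := fun _ => rfl }

/-! ### Images and existential quantification -/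

/-- The least subobject of `Γ` through which `f : Y ⟶ Γ` factors:
`∀ ω : Ω, (∀ y : Y, f(y) = γ ⇒ ω) ⇒ ω`, for `γ : Γ`. -/
def leastFactoring {Y Γ : C} (f : Y ⟶ Γ) : Subobject Γ :=
  all (Omega C) (imp
    (all Y (imp (equalizerSubobject (fst _ _ ≫ f) (snd _ _ ≫ snd _ _))
      (holds (snd _ _ ≫ fst _ _))))
    (holds (fst _ _)))

theorem leastFactoring_factors {Y Γ : C} (f : Y ⟶ Γ) : (leastFactoring f).Factors f := by
  simp only [leastFactoring, all_factors, imp_factors, equalizerSubobject_factors_iff]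
  intro Δ g ω Δ' h H
  have := H (𝟙 _) (h ≫ g) (𝟙 _) (by simp)
  simpa [holds_comp, factors_pullback] using this

theorem leastFactoring_le {Y Γ : C} (f : Y ⟶ Γ) (ψ : Subobject Γ) (hψ : ψ.Factors f) :
    leastFactoring f ≤ ψ := by
  rw [le_iff]
  intro Δ k hk
  simp only [leastFactoring, all_factors, imp_factors, equalizerSubobject_factors_iff] at hk
  have := hk (𝟙 _) (k ≫ char ψ) (𝟙 _) ?_
  · simpa [holds_fst_factors_char] using this
  · intro Δ' g y Δ'' h hy
    have e : h ≫ lift y (g ≫ 𝟙 _ ≫ lift (k ≫ char ψ) (𝟙 _ ≫ k)) ≫ snd Y _ =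
        lift ((h ≫ g ≫ k) ≫ char ψ) (h ≫ g ≫ k) := by
      ext <;> simp
    rw [holds_comp, factors_pullback, Category.assoc, e, holds_fst_factors_char]
    have hy' : h ≫ y ≫ f = h ≫ g ≫ k := by simpa using hy
    rw [← hy', ← Category.assoc]
    exact Subobject.factors_of_factors_right _ hψ

/-- A topos has images. -/
instance hasImages : HasImages C where
  has_image {Y Γ} f := HasImage.mk
    { F :=
        { I := leastFactoring f
          m := (leastFactoring f).arrow
          e := (leastFactoring f).factorThru f (leastFactoring_factors f) }
      isImage :=
        { lift := fun F' => Subobject.ofLEMk _ F'.m (leastFactoring_le f _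
            ((Subobject.mk_factors_iff _ _).2 ⟨F'.e, F'.fac⟩)) } }

/-- Existential quantification over a new variable of type `X`: the image of `φ` under the
projection `X ⊗ Γ ⟶ Γ`. -/
def ex (X : C) {Γ : C} (φ : Subobject (X ⊗ Γ)) : Subobject Γ :=
  imageSubobject (φ.arrow ≫ snd X Γ)

/-! ### The internal language

A context is an object `Γ`, a term of type `X` in the context `Γ` is a morphism `Γ ⟶ X`, and a
formula in the context `Γ` is a subobject of `Γ`.  Propositional connectives are the operations of
the Heyting algebra of subobjects.  A new variable is added at the front of the context, so that the
variables of a context `X₀ ⊗ (X₁ ⊗ ⋯)` are `var0 : X₀` (the last bound one), `var1 : X₁`, and further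
projections.  Applying a morphism `f` to a term `t` is the composite `t ≫ f`. -/

/-- The most recently bound variable. -/
abbrev var0 {X Γ : C} : X ⊗ Γ ⟶ X := fst X Γ

/-- The variable bound before the last one. -/
abbrev var1 {X Y Γ : C} : X ⊗ (Y ⊗ Γ) ⟶ Y := snd X (Y ⊗ Γ) ≫ fst Y Γ

/-- A formula is valid if it is interpreted as the largest subobject of its context. -/
def Valid {Γ : C} (φ : Subobject Γ) : Prop := φ = ⊤

/-- The formula `s = t`. -/
abbrev eqF {Γ X : C} (s t : Γ ⟶ X) : Subobject Γ := equalizerSubobject s t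

/-- The membership relation `∈_X ↣ X × PX`, classified by evaluation, the transpose of the identity
of `PX`. -/
def memRel (X : C) : Subobject (X ⊗ Power X) := holds (MonoidalClosed.uncurry (𝟙 (Power X)))

/-- The formula `x ∈_X A`. -/
def mem {Γ X : C} (x : Γ ⟶ X) (A : Γ ⟶ Power X) : Subobject Γ :=
  (Subobject.pullback (lift x A)).obj (memRel X)

/-- The term `{x : X | φ}`. -/
def compr {X Γ : C} (φ : Subobject (X ⊗ Γ)) : Γ ⟶ Power X := MonoidalClosed.curry (char φ)

/-- `∧ : PX × PX ⟶ PX`. -/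
def meetP (X : C) : Power X ⊗ Power X ⟶ Power X :=
  compr (mem var0 (snd _ _ ≫ fst _ _) ⊓ mem var0 (snd _ _ ≫ snd _ _))

/-- `∨ : PX × PX ⟶ PX`. -/
def joinP (X : C) : Power X ⊗ Power X ⟶ Power X :=
  compr (mem var0 (snd _ _ ≫ fst _ _) ⊔ mem var0 (snd _ _ ≫ snd _ _))

/-- The pseudo-complement `¬ : PX ⟶ PX`. -/
def negP (X : C) : Power X ⟶ Power X := compr (mem var0 (snd _ _))ᶜ

/-- The closed term `∅ : PX`. -/
def emptyP (X : C) : 𝟙_ C ⟶ Power X := compr ⊥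

/-- The closed term `X : PX`. -/
def fullP (X : C) : 𝟙_ C ⟶ Power X := compr ⊤

/-- The order `⪯_X` of `PX`: the equalizer of `∧` and the first projection. -/
def leRel (X : C) : Subobject (Power X ⊗ Power X) := equalizerSubobject (meetP X) (fst _ _)

/-- The formula `A ⪯_X B`. -/
def leF {Γ X : C} (A B : Γ ⟶ Power X) : Subobject Γ :=
  (Subobject.pullback (lift A B)).obj (leRel X)

/-- The term `A ∧ B`. -/
abbrev inter {Γ X : C} (A B : Γ ⟶ Power X) : Γ ⟶ Power X := lift A B ≫ meetP X

/-- The term `A ∨ B`. -/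
abbrev union {Γ X : C} (A B : Γ ⟶ Power X) : Γ ⟶ Power X := lift A B ≫ joinP X

/-! ### Filters, structuring neighborhoods, erosion and dilation -/

/-- `∀ A. ∀ B. A ∈ F ∧ B ∈ F ⇒ A ∧ B ∈ F`, for `F : PPX` in the context. -/
def filterInter (X : C) : Subobject (Power (Power X)) :=
  all (Power X) (all (Power X)
    (mem var1 (snd _ _ ≫ snd _ _) ⊓ mem var0 (snd _ _ ≫ snd _ _) ⇨
      mem (inter var1 var0) (snd _ _ ≫ snd _ _)))

/-- `∀ A. ∀ B. A ∈ F ∧ A ⪯ B ⇒ B ∈ F`, for `F : PPX` in the context. -/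
def filterUpper (X : C) : Subobject (Power (Power X)) :=
  all (Power X) (all (Power X)
    (mem var1 (snd _ _ ≫ snd _ _) ⊓ leF var1 var0 ⇨ mem var0 (snd _ _ ≫ snd _ _)))

/-- `X ∈ F`, for `F : PPX` in the context. -/
def filterNonempty (X : C) : Subobject (Power (Power X)) :=
  mem (toUnit _ ≫ fullP X) (𝟙 _)

/-- `∀ A. A ∈ F ⇒ ∃ x. x ∈ A`, for `F : PPX` in the context. -/
def filterStrict (X : C) : Subobject (Power (Power X)) :=
  all (Power X) (mem var0 (snd _ _) ⇨ ex X (mem var0 var1))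

/-- The morphism `PPX ⟶ Ω` defined by the axioms of (strict) filters. -/
def filterMor (X : C) : Power (Power X) ⟶ Omega C :=
  char (filterInter X ⊓ filterUpper X ⊓ filterNonempty X ⊓ filterStrict X)

/-- The formula saying that the term `F : PPX` is a filter in `X`. -/
def isFilter {Γ X : C} (F : Γ ⟶ Power (Power X)) : Subobject Γ := holds (F ≫ filterMor X)

/-- `N : X ⟶ PPX` is a structuring neighborhood: internally, every `N(x)` is a filter, and `x ∈ A`
for all `A ∈ N(x)`. -/
structure IsStructuringNeighborhood {X : C} (N : X ⟶ Power (Power X)) : Prop where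
  isFilter_apply : Valid (Γ := 𝟙_ C) (all X (isFilter (var0 ≫ N)))
  mem_of_mem : Valid (Γ := 𝟙_ C) (all X (all (Power X) (mem var0 (var1 ≫ N) ⇨ mem var1 var0)))

/-- The erosion `ε[N](Y) = {x : X | Y ∈ N(x)}`. -/
def erosion {X : C} (N : X ⟶ Power (Power X)) : Power X ⟶ Power X :=
  compr (X := X) (mem (snd _ _) (var0 ≫ N))

/-- The dilation `δ[N](Y) = {x : X | ∃ F. F is a filter ∧ Y ∈ F ∧ N(x) ⪯ F}`. -/
def dilation {X : C} (N : X ⟶ Power (Power X)) : Power X ⟶ Power X :=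
  compr (X := X) (ex (Power (Power X))
    (isFilter var0 ⊓ mem (snd _ _ ≫ snd _ _) var0 ⊓ leF (var1 ≫ N) var0))

/-- The second expression of the dilation, `{x : X | ∀ A. A ∈ N(x) ⇒ ∃ y. y ∈ A ∧ Y}`. -/
def dilation' {X : C} (N : X ⟶ Power (Power X)) : Power X ⟶ Power X :=
  compr (X := X) (all (Power X)
    (mem var0 (var1 ≫ N) ⇨ ex X (mem var0 (inter var1 (snd _ _ ≫ snd _ _ ≫ snd _ _)))))

end

end

end ElementaryTopos

open ElementaryTopos

namespace ElementaryTopos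

/-! ### Forcing semantics of the internal language -/

section Forcing

/-! Kripke–Joyal style: a subobject is determined by the generalised elements factoring through it,
so each formula is unfolded into a condition on elements at all later stages, where ordinary
arguments apply. Disjunctions and existentials yield no witness at the current stage; they are used
only to prove another formula, which `factors_of_sup_factors` and `factors_of_ex_factors` justify
without covers. Comprehension obeys a β-rule (`mem_comp_compr`) and extensionality
(`eq_of_mem_iff`).

The one substantial point is `mem_comp_dilation`: some strict filter contains `Y` and refines `N(x)`
iff every `A` in `N(x)` meets `Y`. Given the filter, `A ∧ Y` lies in it and is inhabited by
strictness. Conversely, the sets containing some `A ∧ Y` with `A ∈ N(x)` form such a filter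
(`isFilter_adjoinFilter`). With this description of `δ[N]`, all the stated laws follow from the
filter axioms for `N(x)` and from `x ∈ A` for `A ∈ N(x)`. -/

theorem valid_iff {C : Type*} [Category* C] {Γ : C} (φ : Subobject Γ) :
    Valid φ ↔ ∀ ⦃Δ : C⦄ (f : Δ ⟶ Γ), φ.Factors f := by
  simp [Valid, ext_iff', Subobject.top_factors]

variable {C : Type*} [Category* C] [CartesianMonoidalCategory C] [ElementaryTopos C]

/-! ### Forcing of connectives and of the existential quantifier. -/

theorem inf_factors_iff {Γ Δ : C} (φ ψ : Subobject Γ) (f : Δ ⟶ Γ) :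
    (φ ⊓ ψ).Factors f ↔ φ.Factors f ∧ ψ.Factors f :=
  Subobject.inf_factors f

theorem himp_factors {Γ Δ : C} (φ ψ : Subobject Γ) (f : Δ ⟶ Γ) :
    (φ ⇨ ψ).Factors f ↔
      ∀ ⦃Δ' : C⦄ (g : Δ' ⟶ Δ), φ.Factors (g ≫ f) → ψ.Factors (g ≫ f) :=
  imp_factors φ ψ f

theorem compl_factors {Γ Δ : C} (φ : Subobject Γ) (f : Δ ⟶ Γ) :
    φᶜ.Factors f ↔
      ∀ ⦃Δ' : C⦄ (g : Δ' ⟶ Δ), φ.Factors (g ≫ f) → (⊥ : Subobject Γ).Factors (g ≫ f) :=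
  imp_factors φ (bottom Γ) f

/-- A false formula, true at some stage, forces every formula at that stage. -/
theorem factors_of_bot_factors {Γ Γ' Δ : C} {f : Δ ⟶ Γ} (h : (⊥ : Subobject Γ).Factors f)
    (ψ : Subobject Γ') (k : Δ ⟶ Γ') : ψ.Factors k := by
  -- Falsity is `∀ ω, ω`; the truth value chosen for `ω` is that of `ψ` at `k`.
  have h' := (all_factors _ _).1 (show (bottom Γ).Factors f from h) (𝟙 _) (k ≫ char ψ)
  rw [holds_fst_factors, holds_comp_char, ext_iff'] at h'
  simpa [factors_pullback, Subobject.top_factors] using h' (𝟙 _)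

/-- Elimination of a disjunction: a formula holds at a stage if it holds at all later stages where
one of the disjuncts does. -/
theorem factors_of_sup_factors {Γ Γ' Δ : C} {φ₁ φ₂ : Subobject Γ} {f : Δ ⟶ Γ}
    (h : (φ₁ ⊔ φ₂).Factors f) (ψ : Subobject Γ') (k : Δ ⟶ Γ')
    (h₁ : ∀ ⦃Δ' : C⦄ (g : Δ' ⟶ Δ), φ₁.Factors (g ≫ f) → ψ.Factors (g ≫ k))
    (h₂ : ∀ ⦃Δ' : C⦄ (g : Δ' ⟶ Δ), φ₂.Factors (g ≫ f) → ψ.Factors (g ≫ k)) :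
    ψ.Factors k := by
  -- `ψ` lives over another context, so it is replaced by a bound over `Γ`: `∀ d : Δ, f(d) = γ ⇒
  -- ψ(k(d))`. Both disjuncts lie below it, and evaluating at `γ = f`, `d = 𝟙` returns `ψ` at `k`.
  have hle : φ₁ ⊔ φ₂ ≤ all Δ (imp (equalizerSubobject (fst Δ Γ ≫ f) (snd Δ Γ))
      ((Subobject.pullback (fst Δ Γ ≫ k)).obj ψ)) := by
    refine sup_le ?_ ?_ <;> rw [le_iff] <;> intro Δ' g hg <;>
      simp only [all_factors, imp_factors, equalizerSubobject_factors_iff, factors_pullback,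
        comp_lift, lift_fst_assoc, lift_snd] <;>
      intro Δ₁ a x Δ₂ b e
    · have := h₁ (b ≫ x) (by
        rw [e]
        exact Subobject.factors_of_factors_right _ (Subobject.factors_of_factors_right _ hg))
      simpa using this
    · have := h₂ (b ≫ x) (by
        rw [e]
        exact Subobject.factors_of_factors_right _ (Subobject.factors_of_factors_right _ hg))
      simpa using this
  have := (all_factors _ _).1 (Subobject.factors_of_le _ hle h) (𝟙 _) (𝟙 _)
  rw [imp_factors] at this
  simpa [factors_pullback] using this (𝟙 _) (by rw [equalizerSubobject_factors_iff]; simp)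

theorem factors_ex {X Γ Δ : C} {φ : Subobject (X ⊗ Γ)} {f : Δ ⟶ Γ} (x : Δ ⟶ X)
    (h : φ.Factors (lift x f)) : (ex X φ).Factors f := by
  have e : φ.factorThru _ h ≫ φ.arrow ≫ snd X Γ = f := by simp
  rw [← e, ex]
  exact Subobject.factors_of_factors_right _ (by
    simpa using imageSubobject_factors_comp_self (f := φ.arrow ≫ snd X Γ) (𝟙 _))

/-- Elimination of an existential quantifier. -/
theorem factors_of_ex_factors {X Γ Γ' Δ : C} {φ : Subobject (X ⊗ Γ)} {f : Δ ⟶ Γ}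
    (h : (ex X φ).Factors f) (ψ : Subobject Γ') (k : Δ ⟶ Γ')
    (H : ∀ ⦃Δ' : C⦄ (g : Δ' ⟶ Δ) (x : Δ' ⟶ X), φ.Factors (lift x (g ≫ f)) → ψ.Factors (g ≫ k)) :
    ψ.Factors k := by
  -- The same bound `∀ d : Δ, f(d) = γ ⇒ ψ(k(d))`, now compared with an image: minimality of the
  -- image reduces the claim to generalised points of `φ`, whose first component is the witness.
  have hle : ex X φ ≤ all Δ (imp (equalizerSubobject (fst Δ Γ ≫ f) (snd Δ Γ))
      ((Subobject.pullback (fst Δ Γ ≫ k)).obj ψ)) := by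
    refine imageSubobject_le _ (Subobject.factorThru _ _ ?_) (Subobject.factorThru_arrow _ _ _)
    simp only [all_factors, imp_factors, equalizerSubobject_factors_iff, factors_pullback,
      comp_lift, lift_fst_assoc, lift_snd]
    intro Δ₁ a x Δ₂ b e
    have := H (b ≫ x) (b ≫ a ≫ φ.arrow ≫ fst X Γ) (by
      have e' : lift (b ≫ a ≫ φ.arrow ≫ fst X Γ) ((b ≫ x) ≫ f) = b ≫ a ≫ φ.arrow := by
        ext <;> simp [e]
      rw [e', ← Category.assoc]
      exact Subobject.factors_comp_arrow _)
    simpa using this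
  have := (all_factors _ _).1 (Subobject.factors_of_le _ hle h) (𝟙 _) (𝟙 _)
  rw [imp_factors] at this
  simpa [factors_pullback] using this (𝟙 _) (by rw [equalizerSubobject_factors_iff]; simp)

/-- The generalised element `x` is a member of `A`. -/
def Mem {Γ X : C} (x : Γ ⟶ X) (A : Γ ⟶ Power X) : Prop := (memRel X).Factors (lift x A)

/-! ### Membership, inclusion and inhabitedness of generalised elements. -/

theorem Mem.comp {Γ Δ X : C} {x : Γ ⟶ X} {A : Γ ⟶ Power X} (h : Mem x A) (g : Δ ⟶ Γ) :
    Mem (g ≫ x) (g ≫ A) := by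
  rw [Mem, ← comp_lift]
  exact Subobject.factors_of_factors_right g h

theorem mem_factors {Γ Δ X : C} (x : Γ ⟶ X) (A : Γ ⟶ Power X) (f : Δ ⟶ Γ) :
    (mem x A).Factors f ↔ Mem (f ≫ x) (f ≫ A) := by
  rw [mem, factors_pullback, comp_lift, Mem]

/-- The β-rule for comprehension: evaluating the transpose of a characteristic morphism gives that
morphism back. -/
theorem mem_comp_compr {X Γ Δ : C} (x : Δ ⟶ X) (f : Δ ⟶ Γ) (φ : Subobject (X ⊗ Γ)) :
    Mem x (f ≫ compr φ) ↔ φ.Factors (lift x f) := by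
  have e : lift x (f ≫ compr φ) ≫ MonoidalClosed.uncurry (𝟙 (Power X)) = lift x f ≫ char φ := by
    rw [← lift_whiskerLeft, Category.assoc, ← MonoidalClosed.uncurry_natural_left,
      Category.comp_id, compr, MonoidalClosed.uncurry_curry]
  rw [Mem, memRel, holds, factors_pullback, e, ← factors_pullback, ← holds, holds_char]

/-- Extensionality follows from the η-rule `{x | x ∈ A} = A`, since equal subobjects have equal
comprehensions. -/
theorem eq_of_mem_iff {Γ X : C} {A B : Γ ⟶ Power X}
    (h : ∀ ⦃Δ : C⦄ (g : Δ ⟶ Γ) (x : Δ ⟶ X), Mem x (g ≫ A) ↔ Mem x (g ≫ B)) : A = B := by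
  have key (A : Γ ⟶ Power X) : compr (mem (fst X Γ) (snd X Γ ≫ A)) = A := by
    rw [compr, mem, memRel, ← holds_comp, char_holds, ← lift_whiskerLeft, lift_fst_snd,
      Category.id_comp, ← MonoidalClosed.uncurry_natural_left, Category.comp_id,
      MonoidalClosed.curry_uncurry]
  rw [← key A, ← key B]
  congr 1
  rw [ext_iff']
  intro Δ f
  simpa [mem_factors] using h (f ≫ snd _ _) (f ≫ fst _ _)

@[simp]
theorem comp_inter {Γ Δ X : C} (f : Δ ⟶ Γ) (A B : Γ ⟶ Power X) :
    f ≫ inter A B = inter (f ≫ A) (f ≫ B) :=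
  comp_lift_assoc _ _ _ _

@[simp]
theorem comp_union {Γ Δ X : C} (f : Δ ⟶ Γ) (A B : Γ ⟶ Power X) :
    f ≫ union A B = union (f ≫ A) (f ≫ B) :=
  comp_lift_assoc _ _ _ _

theorem mem_inter {Γ X : C} (x : Γ ⟶ X) (A B : Γ ⟶ Power X) :
    Mem x (inter A B) ↔ Mem x A ∧ Mem x B := by
  simp [inter, meetP, mem_comp_compr, mem_factors]

theorem mem_union {Γ X : C} (x : Γ ⟶ X) (A B : Γ ⟶ Power X) :
    Mem x (union A B) ↔ (mem (fst X _) (snd X _ ≫ fst _ _) ⊔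
      mem (fst X _) (snd X _ ≫ snd _ _)).Factors (lift x (lift A B)) := by
  rw [union, joinP, mem_comp_compr]

theorem mem_fullP {Γ X : C} (x : Γ ⟶ X) (f : Γ ⟶ 𝟙_ C) : Mem x (f ≫ fullP X) := by
  rw [fullP, mem_comp_compr]
  exact Subobject.top_factors _

/-- The conclusion is forcing of `⊥` rather than `False`, because some stages, such as an initial
object, do force `⊥`. -/
theorem mem_comp_negP {Γ X : C} (x : Γ ⟶ X) (A : Γ ⟶ Power X) :
    Mem x (A ≫ negP X) ↔
      ∀ ⦃Δ : C⦄ (g : Δ ⟶ Γ), Mem (g ≫ x) (g ≫ A) →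
        (⊥ : Subobject (X ⊗ Power X)).Factors (g ≫ lift x A) := by
  simp [negP, mem_comp_compr, compl_factors, mem_factors]

/-- The generalised element `A` of a power object is contained in `B`. -/
def Le {Γ X : C} (A B : Γ ⟶ Power X) : Prop :=
  ∀ ⦃Δ : C⦄ (g : Δ ⟶ Γ) (x : Δ ⟶ X), Mem x (g ≫ A) → Mem x (g ≫ B)

theorem leF_factors {Γ Δ X : C} (A B : Γ ⟶ Power X) (f : Δ ⟶ Γ) :
    (leF A B).Factors f ↔ Le (f ≫ A) (f ≫ B) := by
  rw [leF, leRel, factors_pullback, equalizerSubobject_factors_iff, comp_lift, lift_fst]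
  constructor
  · intro h Δ' g x hx
    rw [← h, comp_inter, mem_inter] at hx
    exact hx.2
  · intro h
    refine eq_of_mem_iff fun Δ' g x => ?_
    rw [comp_inter, mem_inter]
    exact ⟨fun h => h.1, fun hx => ⟨hx, h g x hx⟩⟩

theorem Le.mem {Γ X : C} {A B : Γ ⟶ Power X} (h : Le A B) {x : Γ ⟶ X} (hx : Mem x A) :
    Mem x B := by
  simpa using h (𝟙 _) x (by simpa using hx)

theorem Le.comp {Γ Δ X : C} {A B : Γ ⟶ Power X} (h : Le A B) (g : Δ ⟶ Γ) :
    Le (g ≫ A) (g ≫ B) := by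
  intro Δ' k x
  simpa using h (k ≫ g) x

theorem Le.trans {Γ X : C} {A B D : Γ ⟶ Power X} (h : Le A B) (h' : Le B D) : Le A D :=
  fun _ g x hx => h' g x (h g x hx)

theorem inter_le_inter {Γ X : C} {A A' B B' : Γ ⟶ Power X} (h : Le A A') (h' : Le B B') :
    Le (inter A B) (inter A' B') := by
  intro Δ g x
  simp only [comp_inter, mem_inter]
  exact fun hx => ⟨h g x hx.1, h' g x hx.2⟩

/-- The generalised element `A` of a power object is internally inhabited. -/
def Inhabited {Γ X : C} (A : Γ ⟶ Power X) : Prop := (ex X (mem var0 (snd X Γ ≫ A))).Factors (𝟙 Γ)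

theorem Inhabited.of_mem {Γ X : C} {A : Γ ⟶ Power X} {x : Γ ⟶ X} (h : Mem x A) : Inhabited A :=
  factors_ex x (by simpa [mem_factors] using h)

theorem Inhabited.elim {Γ Γ' X : C} {A : Γ ⟶ Power X} (h : Inhabited A) (ψ : Subobject Γ')
    (k : Γ ⟶ Γ')
    (H : ∀ ⦃Δ : C⦄ (g : Δ ⟶ Γ) (x : Δ ⟶ X), Mem x (g ≫ A) → ψ.Factors (g ≫ k)) : ψ.Factors k :=
  factors_of_ex_factors h ψ k fun _ g x hx => H g x (by simpa [mem_factors] using hx)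

/-- Makes existential formulas independent of their context: only the sets of witnesses at later
stages matter. -/
theorem ex_factors_iff_inhabited {X Γ Δ : C} {φ : Subobject (X ⊗ Γ)} {f : Δ ⟶ Γ} {A : Δ ⟶ Power X}
    (h : ∀ ⦃Δ' : C⦄ (g : Δ' ⟶ Δ) (x : Δ' ⟶ X), φ.Factors (lift x (g ≫ f)) ↔ Mem x (g ≫ A)) :
    (ex X φ).Factors f ↔ Inhabited A := by
  constructor
  · intro H
    refine factors_of_ex_factors H _ _ fun Δ' g x hx => factors_ex x ?_
    simpa [mem_factors] using (h g x).1 hx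
  · intro H
    exact H.elim _ _ fun Δ' g x hx => factors_ex x ((h g x).2 hx)

theorem Inhabited.mono {Γ X : C} {A B : Γ ⟶ Power X} (h : Inhabited A) (hAB : Le A B) :
    Inhabited B :=
  h.elim _ _ fun _ g x hx => factors_ex x (by simpa [mem_factors] using hAB g x hx)

/-- The generalised element `F` of `PPX` is a strict filter. -/
structure IsFilter {Γ X : C} (F : Γ ⟶ Power (Power X)) : Prop where
  inter_mem : ∀ ⦃Δ : C⦄ (g : Δ ⟶ Γ) (A B : Δ ⟶ Power X),
    Mem A (g ≫ F) → Mem B (g ≫ F) → Mem (inter A B) (g ≫ F)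
  mem_of_le : ∀ ⦃Δ : C⦄ (g : Δ ⟶ Γ) (A B : Δ ⟶ Power X), Mem A (g ≫ F) → Le A B → Mem B (g ≫ F)
  full_mem : Mem (toUnit _ ≫ fullP X) F
  inhabited : ∀ ⦃Δ : C⦄ (g : Δ ⟶ Γ) (A : Δ ⟶ Power X), Mem A (g ≫ F) → Inhabited A

/-! ### Filter axioms in terms of generalised elements. -/

theorem filterInter_factors {Γ X : C} (F : Γ ⟶ Power (Power X)) :
    (filterInter X).Factors F ↔ ∀ ⦃Δ : C⦄ (g : Δ ⟶ Γ) (A B : Δ ⟶ Power X),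
      Mem A (g ≫ F) → Mem B (g ≫ F) → Mem (inter A B) (g ≫ F) := by
  simp only [filterInter, all_factors, himp_factors, inf_factors_iff, mem_factors]
  constructor
  · intro h Δ g A B hA hB
    simpa using h g A (𝟙 _) B (𝟙 _) (by simpa using ⟨hA, hB⟩)
  · intro h Δ₁ g₁ A Δ₂ g₂ B Δ₃ g₃ hAB
    simpa using h (g₃ ≫ g₂ ≫ g₁) (g₃ ≫ g₂ ≫ A) (g₃ ≫ B) (by simpa using hAB.1)
      (by simpa using hAB.2)

theorem filterUpper_factors {Γ X : C} (F : Γ ⟶ Power (Power X)) :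
    (filterUpper X).Factors F ↔ ∀ ⦃Δ : C⦄ (g : Δ ⟶ Γ) (A B : Δ ⟶ Power X),
      Mem A (g ≫ F) → Le A B → Mem B (g ≫ F) := by
  simp only [filterUpper, all_factors, himp_factors, inf_factors_iff, mem_factors, leF_factors]
  constructor
  · intro h Δ g A B hA hB
    simpa using h g A (𝟙 _) B (𝟙 _) (by simpa using ⟨hA, hB⟩)
  · intro h Δ₁ g₁ A Δ₂ g₂ B Δ₃ g₃ hAB
    simpa using h (g₃ ≫ g₂ ≫ g₁) (g₃ ≫ g₂ ≫ A) (g₃ ≫ B) (by simpa using hAB.1)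
      (by simpa using hAB.2)

theorem filterNonempty_factors {Γ X : C} (F : Γ ⟶ Power (Power X)) :
    (filterNonempty X).Factors F ↔ Mem (toUnit _ ≫ fullP X) F := by
  simp [filterNonempty, mem_factors]

theorem filterStrict_factors {Γ X : C} (F : Γ ⟶ Power (Power X)) :
    (filterStrict X).Factors F ↔
      ∀ ⦃Δ : C⦄ (g : Δ ⟶ Γ) (A : Δ ⟶ Power X), Mem A (g ≫ F) → Inhabited A := by
  have key {Δ : C} (g : Δ ⟶ Γ) (A : Δ ⟶ Power X) :
      (ex X (mem var0 var1)).Factors (lift A (g ≫ F)) ↔ Inhabited A :=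
    ex_factors_iff_inhabited fun Δ' k x => by simp [mem_factors]
  simp only [filterStrict, all_factors, himp_factors, mem_factors]
  constructor
  · intro h Δ g A hA
    rw [← key g]
    simpa using h g A (𝟙 _) (by simpa using hA)
  · intro h Δ₁ g₁ A Δ₂ g₂ hA
    have := (key (g₂ ≫ g₁) (g₂ ≫ A)).2 (h (g₂ ≫ g₁) (g₂ ≫ A) (by simpa using hA))
    simpa using this

theorem isFilter_factors {Γ Δ X : C} (F : Γ ⟶ Power (Power X)) (f : Δ ⟶ Γ) :
    (isFilter F).Factors f ↔ IsFilter (f ≫ F) := by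
  rw [isFilter, filterMor, holds_comp_char, factors_pullback, inf_factors_iff, inf_factors_iff,
    inf_factors_iff, filterInter_factors, filterUpper_factors, filterNonempty_factors,
    filterStrict_factors]
  exact ⟨fun ⟨⟨⟨h₁, h₂⟩, h₃⟩, h₄⟩ => ⟨h₁, h₂, h₃, h₄⟩,
    fun ⟨h₁, h₂, h₃, h₄⟩ => ⟨⟨⟨h₁, h₂⟩, h₃⟩, h₄⟩⟩

/-! ### Validity of closed universal formulas. -/

theorem valid_all_iff {X : C} (φ : Subobject (X ⊗ 𝟙_ C)) :
    Valid (all X φ) ↔ ∀ ⦃Γ : C⦄ (x : Γ ⟶ X), φ.Factors (lift x (toUnit Γ)) := by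
  simp only [valid_iff, all_factors]
  constructor
  · intro h Γ x
    simpa using h (toUnit Γ) (𝟙 _) x
  · intro h Δ f Δ' g x
    rw [toUnit_unique (g ≫ f) (toUnit _)]
    exact h x

theorem valid_all_all_iff {X Y : C} (φ : Subobject (Y ⊗ X ⊗ 𝟙_ C)) :
    Valid (all X (all Y φ)) ↔
      ∀ ⦃Γ : C⦄ (x : Γ ⟶ X) (y : Γ ⟶ Y), φ.Factors (lift y (lift x (toUnit Γ))) := by
  simp only [valid_all_iff, all_factors]
  constructor
  · intro h Γ x y
    simpa using h x (𝟙 _) y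
  · intro h Γ x Δ g y
    simpa using h (g ≫ x) y

theorem valid_all_all_himp_iff {X Y : C} (φ ψ : Subobject (Y ⊗ X ⊗ 𝟙_ C)) :
    Valid (all X (all Y (φ ⇨ ψ))) ↔
      ∀ ⦃Γ : C⦄ (x : Γ ⟶ X) (y : Γ ⟶ Y), φ.Factors (lift y (lift x (toUnit Γ))) →
        ψ.Factors (lift y (lift x (toUnit Γ))) := by
  simp only [valid_all_all_iff, himp_factors]
  constructor
  · intro h Γ x y hφ
    simpa using h x y (𝟙 _) (by simpa using hφ)
  · intro h Γ x y Δ g hφ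
    simpa using h (g ≫ x) (g ≫ y) (by simpa using hφ)

/-! ### Erosion and dilation -/

variable {X : C} {N : X ⟶ Power (Power X)}

theorem IsStructuringNeighborhood.isFilter (hN : IsStructuringNeighborhood N) {Γ : C}
    (x : Γ ⟶ X) : IsFilter (x ≫ N) := by
  have := (valid_all_iff _).1 hN.isFilter_apply x
  simpa [isFilter_factors] using this

theorem IsStructuringNeighborhood.mem (hN : IsStructuringNeighborhood N) {Γ : C}
    {x : Γ ⟶ X} {A : Γ ⟶ Power X} (h : Mem A (x ≫ N)) : Mem x A := by
  have := (valid_all_all_himp_iff _ _).1 hN.mem_of_mem x A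
  simpa [mem_factors, h] using this

theorem mem_comp_erosion {Γ : C} (x : Γ ⟶ X) (Y : Γ ⟶ Power X) :
    Mem x (Y ≫ erosion N) ↔ Mem Y (x ≫ N) := by
  simp [erosion, mem_comp_compr, mem_factors]

theorem mem_comp_dilation' {Γ : C} (x : Γ ⟶ X) (Y : Γ ⟶ Power X) :
    Mem x (Y ≫ dilation' N) ↔ ∀ ⦃Δ : C⦄ (g : Δ ⟶ Γ) (A : Δ ⟶ Power X),
      Mem A (g ≫ x ≫ N) → Inhabited (inter A (g ≫ Y)) := by
  have key {Δ : C} (g : Δ ⟶ Γ) (A : Δ ⟶ Power X) :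
      (ex X (mem var0 (inter var1 (snd _ _ ≫ snd _ _ ≫ snd _ _)))).Factors
        (lift A (lift (g ≫ x) (g ≫ Y))) ↔ Inhabited (inter A (g ≫ Y)) :=
    ex_factors_iff_inhabited fun Δ' k x => by simp [mem_factors]
  simp only [dilation', mem_comp_compr, all_factors, himp_factors, mem_factors]
  constructor
  · intro h Δ g A hA
    rw [← key]
    simpa using h g A (𝟙 _) (by simpa using hA)
  · intro h Δ₁ g₁ A Δ₂ g₂ hA
    have := (key (g₂ ≫ g₁) (g₂ ≫ A)).2 (h (g₂ ≫ g₁) (g₂ ≫ A) (by simpa using hA))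
    simpa using this

/-- The filter `{B | ∃ A. A ∈ G ∧ A ∧ Y ⪯ B}` generated by `G` and `Y`. -/
noncomputable def adjoinFilter {Γ : C} (G : Γ ⟶ Power (Power X)) (Y : Γ ⟶ Power X) :
    Γ ⟶ Power (Power X) :=
  compr (X := Power X) (ex (Power X)
    (mem var0 (snd _ _ ≫ snd _ _ ≫ G) ⊓ leF (inter var0 (snd _ _ ≫ snd _ _ ≫ Y)) var1))

theorem mem_adjoinFilter {Γ Δ : C} {G : Γ ⟶ Power (Power X)} {Y : Γ ⟶ Power X} {f : Δ ⟶ Γ}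
    {B : Δ ⟶ Power X} (A : Δ ⟶ Power X) (hA : Mem A (f ≫ G)) (h : Le (inter A (f ≫ Y)) B) :
    Mem B (f ≫ adjoinFilter G Y) := by
  rw [adjoinFilter, mem_comp_compr]
  refine factors_ex A ?_
  simpa [mem_factors, leF_factors] using ⟨hA, h⟩

theorem factors_of_mem_adjoinFilter {Γ Γ' Δ : C} {G : Γ ⟶ Power (Power X)} {Y : Γ ⟶ Power X}
    {f : Δ ⟶ Γ} {B : Δ ⟶ Power X} (h : Mem B (f ≫ adjoinFilter G Y)) (ψ : Subobject Γ')
    (k : Δ ⟶ Γ') (H : ∀ ⦃Δ' : C⦄ (g : Δ' ⟶ Δ) (A : Δ' ⟶ Power X), Mem A (g ≫ f ≫ G) →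
      Le (inter A (g ≫ f ≫ Y)) (g ≫ B) → ψ.Factors (g ≫ k)) : ψ.Factors k := by
  rw [adjoinFilter, mem_comp_compr] at h
  refine factors_of_ex_factors h ψ k fun Δ' g A hA => ?_
  simp [mem_factors, leF_factors] at hA
  exact H g A hA.1 hA.2

/-- Strictness is exactly the hypothesis that members of `G` meet `Y`; the other axioms are
inherited from `G`. -/
theorem isFilter_adjoinFilter {Γ : C} {G : Γ ⟶ Power (Power X)} {Y : Γ ⟶ Power X}
    (hG : IsFilter G) (hY : ∀ ⦃Δ : C⦄ (g : Δ ⟶ Γ) (A : Δ ⟶ Power X), Mem A (g ≫ G) →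
      Inhabited (inter A (g ≫ Y))) : IsFilter (adjoinFilter G Y) where
  inter_mem Δ g A B hA hB := by
    refine factors_of_mem_adjoinFilter hA _ _ fun Δ₁ g₁ A' hA' hA'' => ?_
    rw [comp_lift]
    have hB₁ := hB.comp g₁
    rw [← Category.assoc] at hB₁
    refine factors_of_mem_adjoinFilter hB₁ _ _ fun Δ₂ g₂ B' hB' hB'' => ?_
    have : Mem (g₂ ≫ g₁ ≫ inter A B) ((g₂ ≫ g₁ ≫ g) ≫ adjoinFilter G Y) := by
      -- If `A' ∧ Y ⪯ A` and `B' ∧ Y ⪯ B`, then `(A' ∧ B') ∧ Y ⪯ A ∧ B`.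
      refine mem_adjoinFilter (inter (g₂ ≫ A') B') ?_ ?_
      · refine hG.inter_mem _ _ _ ?_ (by simpa using hB')
        simpa using hA'.comp g₂
      · intro Δ₃ g₃ x hx
        simp only [comp_inter, mem_inter] at hx ⊢
        constructor
        · have := hA'' (g₃ ≫ g₂) x
          simp only [comp_inter, mem_inter] at this
          simpa using this ⟨by simpa using hx.1.1, by simpa using hx.2⟩
        · have := hB'' g₃ x
          simp only [comp_inter, mem_inter] at this
          simpa using this ⟨by simpa using hx.1.2, by simpa using hx.2⟩
    simpa [Mem] using this
  mem_of_le Δ g A B hA hAB := by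
    refine factors_of_mem_adjoinFilter hA _ _ fun Δ₁ g₁ A' hA' hA'' => ?_
    have := mem_adjoinFilter (f := g₁ ≫ g) (Y := Y) A' (by simpa using hA')
      (by simpa using hA''.trans (hAB.comp g₁))
    simpa [Mem] using this
  full_mem := by
    have := mem_adjoinFilter (f := 𝟙 Γ) (G := G) (Y := Y) (B := toUnit _ ≫ fullP X) _
      (by simpa using hG.full_mem)
      (fun Δ g x _ => by rw [← Category.assoc]; exact mem_fullP _ _)
    simpa using this
  inhabited Δ g B hB := by
    refine factors_of_mem_adjoinFilter hB _ _ fun Δ₁ g₁ A hA hAB => ?_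
    have := (hY (g₁ ≫ g) A (by simpa using hA)).mono (by simpa using hAB)
    rw [Category.comp_id]
    exact (ex_factors_iff_inhabited fun Δ₂ g₂ x => by simp [mem_factors]).2 this

/-- Replaces the quantifier over filters by one over members of `N(x)`; every later fact about the
dilation goes through this form. -/
theorem mem_comp_dilation (hN : IsStructuringNeighborhood N) {Γ : C} (x : Γ ⟶ X)
    (Y : Γ ⟶ Power X) :
    Mem x (Y ≫ dilation N) ↔ ∀ ⦃Δ : C⦄ (g : Δ ⟶ Γ) (A : Δ ⟶ Power X),
      Mem A (g ≫ x ≫ N) → Inhabited (inter A (g ≫ Y)) := by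
  rw [dilation, mem_comp_compr]
  constructor
  · intro h Δ g A hA
    refine factors_of_ex_factors (Subobject.factors_of_factors_right g h) _ _
      fun Δ' k F hF => ?_
    simp [mem_factors, leF_factors, isFilter_factors] at hF
    obtain ⟨⟨hF, hY⟩, hNF⟩ := hF
    -- Since `N(x) ⪯ F`, both `A` and `Y` belong to `F`.
    have h₁ := hF.inter_mem (𝟙 _) (k ≫ A) (k ≫ g ≫ Y)
      (by simpa using hNF.mem (by simpa using hA.comp k)) (by simpa using hY)
    have := hF.inhabited (𝟙 _) _ h₁
    rw [Category.comp_id]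
    exact (ex_factors_iff_inhabited fun Δ₂ g₂ x => by simp [mem_factors]).2 this
  · intro h
    refine factors_ex (adjoinFilter (x ≫ N) Y) ?_
    simp [mem_factors, leF_factors, isFilter_factors]
    refine ⟨⟨isFilter_adjoinFilter (hN.isFilter x) h, ?_⟩, ?_⟩
    -- `Y` belongs to the generated filter because `X ∈ N(x)` and `X ∧ Y ⪯ Y`.
    · have := mem_adjoinFilter (f := 𝟙 Γ) (G := x ≫ N) (Y := Y) (B := Y) _
        (by simpa using (hN.isFilter x).full_mem)
        (fun Δ g x hx => by
          rw [comp_inter, mem_inter] at hx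
          simpa using hx.2)
      simpa using this
    · intro Δ g A hA
      refine mem_adjoinFilter A hA fun Δ' k y hy => ?_
      rw [comp_inter, mem_inter] at hy
      exact hy.1

/-! ### Algebraic laws of erosion and dilation. -/

theorem dilation_eq_dilation' (hN : IsStructuringNeighborhood N) : dilation N = dilation' N :=
  eq_of_mem_iff fun Δ Y x => by rw [mem_comp_dilation hN, mem_comp_dilation']

theorem erosion_mono (hN : IsStructuringNeighborhood N) {Γ : C} {Y Z : Γ ⟶ Power X}
    (h : Le Y Z) : Le (Y ≫ erosion N) (Z ≫ erosion N) := by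
  intro Δ g x hx
  rw [← Category.assoc, mem_comp_erosion] at hx ⊢
  have := (hN.isFilter x).mem_of_le (𝟙 _) _ _ (by simpa using hx) (h.comp g)
  simpa using this

theorem dilation_mono (hN : IsStructuringNeighborhood N) {Γ : C} {Y Z : Γ ⟶ Power X}
    (h : Le Y Z) : Le (Y ≫ dilation N) (Z ≫ dilation N) := by
  intro Δ g x hx
  rw [← Category.assoc, mem_comp_dilation hN] at hx ⊢
  intro Δ' k A hA
  exact (hx k A hA).mono (inter_le_inter (fun _ _ _ => id) (by simpa using h.comp (k ≫ g)))

/-- One inclusion is upward closure of the filter `N(x)`, the other its closure under intersection.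
-/
theorem inter_comp_erosion (hN : IsStructuringNeighborhood N) {Γ : C} (A B : Γ ⟶ Power X) :
    inter A B ≫ erosion N = inter (A ≫ erosion N) (B ≫ erosion N) := by
  refine eq_of_mem_iff fun Δ g x => ?_
  rw [← Category.assoc, mem_comp_erosion]
  simp only [comp_inter, mem_inter]
  rw [← Category.assoc g, ← Category.assoc g, mem_comp_erosion, mem_comp_erosion]
  have hF := hN.isFilter x
  constructor
  · intro h
    constructor
    · simpa using hF.mem_of_le (𝟙 _) _ (g ≫ A) (by simpa using h) fun Δ' k y hy => by
        rw [comp_inter, mem_inter] at hy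
        exact hy.1
    · simpa using hF.mem_of_le (𝟙 _) _ (g ≫ B) (by simpa using h) fun Δ' k y hy => by
        rw [comp_inter, mem_inter] at hy
        exact hy.2
  · intro h
    simpa using hF.inter_mem (𝟙 _) _ _ (by simpa using h.1) (by simpa using h.2)

theorem fullP_comp_erosion (hN : IsStructuringNeighborhood N) :
    fullP X ≫ erosion N = fullP X := by
  refine eq_of_mem_iff fun Δ g x => ?_
  rw [← Category.assoc, mem_comp_erosion, toUnit_unique g (toUnit _)]
  exact iff_of_true (hN.isFilter x).full_mem (mem_fullP _ _)

theorem erosion_le (hN : IsStructuringNeighborhood N) {Γ : C} (Y : Γ ⟶ Power X) :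
    Le (Y ≫ erosion N) Y := by
  intro Δ g x hx
  rw [← Category.assoc, mem_comp_erosion] at hx
  exact hN.mem hx

theorem union_le {Γ : C} {A B D : Γ ⟶ Power X} (hA : Le A D) (hB : Le B D) :
    Le (union A B) D := by
  intro Δ g x hx
  rw [comp_union, mem_union] at hx
  refine factors_of_sup_factors hx _ _ (fun Δ' k hk => ?_) (fun Δ' k hk => ?_)
  · have := hA (k ≫ g) (k ≫ x) (by simpa [mem_factors] using hk)
    simpa [Mem] using this
  · have := hB (k ≫ g) (k ≫ x) (by simpa [mem_factors] using hk)
    simpa [Mem] using this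

theorem le_union_left {Γ : C} (A B : Γ ⟶ Power X) : Le A (union A B) := by
  intro Δ g x hx
  rw [comp_union, mem_union]
  exact Subobject.factors_of_le _ le_sup_left (by simpa [mem_factors] using hx)

theorem le_union_right {Γ : C} (A B : Γ ⟶ Power X) : Le B (union A B) := by
  intro Δ g x hx
  rw [comp_union, mem_union]
  exact Subobject.factors_of_le _ le_sup_right (by simpa [mem_factors] using hx)

theorem emptyP_comp_dilation (hN : IsStructuringNeighborhood N) :
    emptyP X ≫ dilation N = emptyP X := by
  refine eq_of_mem_iff fun Δ g x => ⟨fun h => ?_, fun h => ?_⟩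
  · rw [← Category.assoc, mem_comp_dilation hN] at h
    -- Testing against `X ∈ N(x)` yields a point of `X ∧ ∅`.
    have := h (𝟙 _) _ (by simpa using (hN.isFilter x).full_mem)
    refine this.elim _ _ fun Δ' k y hy => ?_
    rw [comp_inter, mem_inter, Category.id_comp] at hy
    have hy' := hy.2
    rw [← Category.assoc, emptyP, mem_comp_compr] at hy'
    exact factors_of_bot_factors hy' _ _
  · rw [emptyP, mem_comp_compr] at h
    exact factors_of_bot_factors h _ _

theorem le_dilation (hN : IsStructuringNeighborhood N) {Γ : C} (Y : Γ ⟶ Power X) :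
    Le Y (Y ≫ dilation N) := by
  intro Δ g x hx
  rw [← Category.assoc, mem_comp_dilation hN]
  intro Δ' k A hA
  -- The point `x` itself witnesses that `A` meets `Y`.
  refine .of_mem (x := k ≫ x) ((mem_inter _ _ _).2 ⟨hN.mem (by simpa using hA), hx.comp k⟩)

theorem negP_comp_erosion_le (hN : IsStructuringNeighborhood N) {Γ : C} (Y : Γ ⟶ Power X) :
    Le (Y ≫ negP X ≫ erosion N) (Y ≫ dilation N ≫ negP X) := by
  intro Δ g x hx
  rw [← Category.assoc, ← Category.assoc, mem_comp_erosion] at hx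
  rw [← Category.assoc, ← Category.assoc, mem_comp_negP]
  intro Δ' k hk
  rw [Category.assoc, ← Category.assoc, ← Category.assoc, mem_comp_dilation hN] at hk
  -- Here `¬Y ∈ N(x)` serves as the test set for `x ∈ δ[N](Y)`, so `¬Y ∧ Y` would be inhabited.
  have := hk (𝟙 _) (k ≫ (g ≫ Y) ≫ negP X) (by simpa using hx.comp k)
  refine this.elim _ _ fun Δ'' l y hy => ?_
  rw [comp_inter, mem_inter] at hy
  have hy' := hy.1
  simp only [← Category.assoc] at hy'
  rw [mem_comp_negP] at hy'
  exact factors_of_bot_factors (hy' (𝟙 _) (by simpa using hy.2)) _ _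

end Forcing

end ElementaryTopos

theorem proposition5 {C : Type*} [Category* C] [CartesianMonoidalCategory C]
    [ElementaryTopos C] {X : C} (N : X ⟶ Power (Power X)) (hN : IsStructuringNeighborhood N) :
    -- the two expressions of the dilation agree
    dilation N = dilation' N ∧
    -- `∀ Y. ∀ Z. Y ⪯ Z ⇒ ε[N](Y) ⪯ ε[N](Z)`
    Valid (Γ := 𝟙_ C) (all (Power X) (all (Power X)
      (leF var1 var0 ⇨ leF (var1 ≫ erosion N) (var0 ≫ erosion N)))) ∧
    -- `∀ Y. ∀ Z. Y ⪯ Z ⇒ δ[N](Y) ⪯ δ[N](Z)`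
    Valid (Γ := 𝟙_ C) (all (Power X) (all (Power X)
      (leF var1 var0 ⇨ leF (var1 ≫ dilation N) (var0 ≫ dilation N)))) ∧
    -- `∀ A. ∀ B. ε[N](A ∧ B) = ε[N](A) ∧ ε[N](B)`
    Valid (Γ := 𝟙_ C) (all (Power X) (all (Power X)
      (eqF (inter var1 var0 ≫ erosion N) (inter (var1 ≫ erosion N) (var0 ≫ erosion N))))) ∧
    -- `ε[N](X) = X`
    Valid (eqF (fullP X ≫ erosion N) (fullP X)) ∧
    -- `∀ Y. ε[N](Y) ⪯ Y`
    Valid (Γ := 𝟙_ C) (all (Power X) (leF (var0 ≫ erosion N) var0)) ∧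
    -- `∀ A. ∀ B. δ[N](A) ∨ δ[N](B) ⪯ δ[N](A ∨ B)`
    Valid (Γ := 𝟙_ C) (all (Power X) (all (Power X)
      (leF (union (var1 ≫ dilation N) (var0 ≫ dilation N)) (union var1 var0 ≫ dilation N)))) ∧
    -- `δ[N](∅) = ∅`
    Valid (eqF (emptyP X ≫ dilation N) (emptyP X)) ∧
    -- `∀ Y. Y ⪯ δ[N](Y)`
    Valid (Γ := 𝟙_ C) (all (Power X) (leF var0 (var0 ≫ dilation N))) ∧
    -- `∀ Y. ε[N](¬ Y) ⪯ ¬ δ[N](Y)`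
    Valid (Γ := 𝟙_ C) (all (Power X)
      (leF (var0 ≫ negP X ≫ erosion N) (var0 ≫ dilation N ≫ negP X))) := by
  refine ⟨dilation_eq_dilation' hN, ?_, ?_, ?_, ?_, ?_, ?_, ?_, ?_, ?_⟩
  · simp only [valid_all_all_himp_iff, leF_factors]
    intro Γ Y Z h
    simpa using erosion_mono hN (by simpa using h)
  · simp only [valid_all_all_himp_iff, leF_factors]
    intro Γ Y Z h
    simpa using dilation_mono hN (by simpa using h)
  · simp only [valid_all_all_iff, equalizerSubobject_factors_iff]
    intro Γ A B
    rw [← Category.assoc, comp_inter, comp_inter]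
    simpa only [Category.assoc, lift_fst, lift_snd_assoc, lift_fst_assoc] using
      inter_comp_erosion hN A B
  · simp [valid_iff, Subobject.top_factors, fullP_comp_erosion hN]
  · simp only [valid_all_iff, leF_factors]
    intro Γ Y
    simpa using erosion_le hN Y
  · simp only [valid_all_all_iff, leF_factors]
    intro Γ A B
    rw [comp_union, ← Category.assoc _ (union var1 var0), comp_union]
    -- Only monotonicity of the dilation is needed, applied to the two inclusions into `A ∨ B`.
    simpa only [Category.assoc, lift_fst, lift_snd_assoc, lift_fst_assoc] using
      union_le (dilation_mono hN (le_union_left A B))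
      (dilation_mono hN (le_union_right A B))
  · simp [valid_iff, Subobject.top_factors, emptyP_comp_dilation hN]
  · simp only [valid_all_iff, leF_factors]
    intro Γ Y
    simpa using le_dilation hN Y
  · simp only [valid_all_iff, leF_factors]
    intro Γ Y
    simpa using negP_comp_erosion_le hN Y
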